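/- **Theorem 1.** Let $G_\Delta$ be the infinite triangular grid, in which every node has six neighbours. A *simply connected particle system* is a finite non-empty set $\mathcal P$ of nodes of $G_\Delta$ (the *particles*) such that the subgraphs of $G_\Delta$ induced by $\mathcal P$ and by its complement are both connected. Every particle numbers its six ports, which lead to its six neighbouring nodes, by $\mathbb Z/6$ so that the ports $i$ and $i+1$ lead to adjacent nodes; different particles may use different starting directions and different chiralities. The certificate (register) of a particle marks each of its six ports as *in* or *out*. An edge between two particles $p,q$ is directed from $p$ to $q$ if $p$ marks it as out and $q$ marks it as in; an edge from a particle to a node outside $\mathcal P$ counts as incoming. A configuration (the system with its ports and certificates) is *valid* if every particle $p$ satisfies: * R1: each edge between $p$ and another particle is oriented, both particles agreeing on its direction; * R2: $p$ has at most three outgoing edges; * R3: in the cyclic order of the ports of $p$, the outgoing edges of $p$ are consecutive; * R4: no triangle of three particles that contains $p$ is a directed cycle. A *sink* is a particle with no outgoing edges. Then R1–R4 form a constant-size proof-labelling scheme for leader election, the leader being the sink: 1. (Soundness) Every valid configuration of a simply connected particle system has exactly one sink. 2. (Completeness) For every simply connected particle system and every numbering of the ports there are certificates for which the configuration is valid and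 has no directed cycle. 3. (Constant size and locality) A certificate takes one of $2^6$ values. Whether $p$ satisfies R1–R4 depends only on which nodes at distance at most one from $p$ are occupied and on how the particles at distance at most one from $p$ mark their incident edges, and it is invariant under the symmetries of $G_\Delta$. 4. Directed cycles (necessarily of length greater than three) are not excluded: there is a valid configuration of a simply connected particle system that contains a directed cycle. -/

import Mathlib

/-! ### The triangular grid -/

/-- Nodes of the infinite triangular grid, in axial coordinates. -/
abbrev Node : Type := ℤ × ℤ

/-- The six unit steps of the triangular grid, in cyclic order. -/
def gridSteps : Finset Node :=
  {(1, 0), (0, 1), (-1, 1), (-1, 0), (0, -1), (1, -1)}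

/-- The infinite triangular grid: every node has six neighbours. -/
def triGrid : SimpleGraph Node where
  Adj p q := q - p ∈ gridSteps
  symm := ⟨by
    intro p q h
    have key : ∀ s ∈ gridSteps, -s ∈ gridSteps := by decide
    have h' := key _ h
    rwa [neg_sub] at h'⟩
  loopless := ⟨by
    intro p h
    rw [sub_self] at h
    exact absurd h (by decide)⟩

/-- The support of a simply connected particle system: a finite set of nodes that induces a
connected (in particular non-empty) subgraph and whose complement induces a connected subgraph. -/
def SimplyConnected (P : Finset Node) : Prop :=
  (triGrid.induce (P : Set Node)).Connected ∧ (triGrid.induce (P : Set Node)ᶜ).Connected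

/-! ### Ports, registers, configurations -/

/-- A port labelling: each particle numbers the edges to its six neighbouring nodes by `ZMod 6` so
that ports `i` and `i + 1` lead to neighbouring nodes. Neither the direction of port `0` nor the
chirality has to be the same at different particles. -/
structure PortLabelling where
  port : Node → ZMod 6 → Node
  injective : ∀ p, Function.Injective (port p)
  adj : ∀ p i, triGrid.Adj p (port p i)
  consecutive : ∀ p i, triGrid.Adj (port p i) (port p (i + 1))

/-- The two values that a particle may write for an incident edge. -/
inductive Link where
  | incoming
  | outgoing
deriving DecidableEq

/-- The certificate of a particle: one direction for each of its six ports. -/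
abbrev Register : Type := ZMod 6 → Link

/-- The contents of all registers; only the values at particles are ever used. -/
abbrev Registers : Type := Node → Register

/-- In the register of `p`, the edge from `p` to its neighbouring node `v` is marked outgoing. -/
def MarksOut (L : PortLabelling) (C : Registers) (p v : Node) : Prop :=
  ∃ i, L.port p i = v ∧ C p i = Link.outgoing

/-- The ports of `p` that carry outgoing edges. An edge to an empty node counts as incoming. -/
def outPorts (P : Finset Node) (L : PortLabelling) (C : Registers) (p : Node) : Finset (ZMod 6) :=
  {i | L.port p i ∈ P ∧ C p i = Link.outgoing}

/-- The edge between the particles `p` and `q` is directed from `p` to `q`, and both particles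
agree on that. -/
def DirectedEdge (P : Finset Node) (L : PortLabelling) (C : Registers) (p q : Node) : Prop :=
  p ∈ P ∧ q ∈ P ∧ triGrid.Adj p q ∧ MarksOut L C p q ∧ ¬ MarksOut L C q p

/-! ### The rules -/

/-- R1: each edge between `p` and another particle is oriented, and both particles agree on its
direction. -/
def RuleOriented (P : Finset Node) (L : PortLabelling) (C : Registers) (p : Node) : Prop :=
  ∀ q ∈ P, triGrid.Adj p q → DirectedEdge P L C p q ∨ DirectedEdge P L C q p

/-- R2: `p` has at most three outgoing edges. -/
def RuleAtMostThree (P : Finset Node) (L : PortLabelling) (C : Registers) (p : Node) : Prop :=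
  (outPorts P L C p).card ≤ 3

/-- R3: in the cyclic order of the ports of `p`, the outgoing edges are consecutive: they are at
the ports `s, s + 1, …, s + (k - 1)` for some `s` and `k`. -/
def RuleConsecutive (P : Finset Node) (L : PortLabelling) (C : Registers) (p : Node) : Prop :=
  ∃ (s : ZMod 6) (k : ℕ), ∀ i, i ∈ outPorts P L C p ↔ ∃ j : ℕ, j < k ∧ i = s + j

/-- R4: no triangle of particles that contains `p` is a directed cycle. -/
def RuleNoCyclicTriangle (P : Finset Node) (L : PortLabelling) (C : Registers) (p : Node) : Prop :=
  ∀ q r,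
    ¬ (DirectedEdge P L C p q ∧ DirectedEdge P L C q r ∧ DirectedEdge P L C r p)

/-- `p` satisfies R1–R4. -/
def LocallyValid (P : Finset Node) (L : PortLabelling) (C : Registers) (p : Node) : Prop :=
  RuleOriented P L C p ∧ RuleAtMostThree P L C p ∧ RuleConsecutive P L C p ∧
    RuleNoCyclicTriangle P L C p

/-- A valid configuration: every particle satisfies R1–R4. -/
def Valid (P : Finset Node) (L : PortLabelling) (C : Registers) : Prop :=
  ∀ p ∈ P, LocallyValid P L C p

/-- A sink: a particle without outgoing edges. -/
def IsSink (P : Finset Node) (L : PortLabelling) (C : Registers) (p : Node) : Prop :=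
  p ∈ P ∧ outPorts P L C p = ∅

/-- `p` lies on a directed cycle. -/
def OnDirectedCycle (P : Finset Node) (L : PortLabelling) (C : Registers) (p : Node) : Prop :=
  Relation.TransGen (DirectedEdge P L C) p p

/-- The symmetry `φ` of the grid carries what is seen at distance at most one from `p` in the first
configuration (which nodes are occupied, and how the particles there mark their incident edges) to
what is seen at distance at most one from `φ p` in the second one. -/
def SameView (φ : triGrid ≃g triGrid) (P : Finset Node) (L : PortLabelling) (C : Registers)
    (P' : Finset Node) (L' : PortLabelling) (C' : Registers) (p : Node) : Prop :=
  ∀ q, (q = p ∨ triGrid.Adj p q) →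
    (q ∈ P ↔ φ q ∈ P') ∧
      (q ∈ P → ∀ v, triGrid.Adj q v → (MarksOut L C q v ↔ MarksOut L' C' (φ q) (φ v)))

/-!
The index of a node is `1`, minus the number of its outgoing edges, plus the number of triangles
that have the node as their source. In an orientation without cyclic triangles every edge and every
triangle has exactly one source, so the indices add up to the Euler characteristic `V - E + F` of
the system, whatever the orientation. If the system is simply connected, this is `1`, as one sees
for the orientation along a scan of the rows by removing the first node: either the system minus
this node stays simply connected, or it falls into two simply connected pieces. By R2 and R3 the
index is `1` at a sink and `0` at every other node, so there is exactly one sink.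

If edges and triangles are shared equally by their nodes instead, the same sum becomes a total
curvature of `6`. Hence some node has positive curvature, its neighbours are then in at most three
consecutive directions, and removing it keeps the system simply connected. Directing all edges from
nodes removed earlier to nodes removed later gives an acyclic valid configuration.
-/

/-! ### Paths inside a set of nodes -/

section Graph

variable {V : Type*} {G : SimpleGraph V} {P S : Set V} {p u v : V}

/-- There is a path from `u` to `v` in `G` all of whose nodes lie in `S`; if `u = v`, then `u` need
not lie in `S`. It replaces reachability in the induced graph on the subtype `S`. -/
def JoinedWithin (G : SimpleGraph V) (S : Set V) : V → V → Prop :=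
  Relation.ReflTransGen fun a b => G.Adj a b ∧ a ∈ S ∧ b ∈ S

namespace JoinedWithin

theorem of_adj (h : G.Adj u v) (hu : u ∈ S) (hv : v ∈ S) : JoinedWithin G S u v :=
  .single ⟨h, hu, hv⟩

theorem refl (u : V) : JoinedWithin G S u u :=
  Relation.ReflTransGen.refl

theorem trans {w : V} (huv : JoinedWithin G S u v) (hvw : JoinedWithin G S v w) :
    JoinedWithin G S u w :=
  Relation.ReflTransGen.trans huv hvw

theorem symm (h : JoinedWithin G S u v) : JoinedWithin G S v u := by
  induction h with
  | refl => exact .refl u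
  | tail _ hbc ih => exact (of_adj hbc.1.symm hbc.2.2 hbc.2.1).trans ih

theorem mono {T : Set V} (hST : S ⊆ T) (h : JoinedWithin G S u v) : JoinedWithin G T u v :=
  Relation.ReflTransGen.mono (fun _ _ h => ⟨h.1, hST h.2.1, hST h.2.2⟩) _ _ h

end JoinedWithin

theorem induce_connected_iff :
    (G.induce S).Connected ↔ S.Nonempty ∧ ∀ u ∈ S, ∀ v ∈ S, JoinedWithin G S u v := by
  rw [SimpleGraph.connected_iff, and_comm, Set.nonempty_coe_sort]
  refine and_congr_right fun _ => ⟨fun h u hu v hv => ?_, fun h u v => ?_⟩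
  · exact ((SimpleGraph.reachable_iff_reflTransGen _ _).1 (h ⟨u, hu⟩ ⟨v, hv⟩)).lift Subtype.val
      fun a b hab => ⟨hab, a.2, b.2⟩
  · have reach : ∀ v, JoinedWithin G S u v → ∃ hv : v ∈ S, (G.induce S).Reachable u ⟨v, hv⟩ := by
      intro v huv
      induction huv with
      | refl => exact ⟨u.2, .refl _⟩
      | tail _ hbc ih =>
        obtain ⟨hb, hub⟩ := ih
        exact ⟨hbc.2.2, hub.trans (SimpleGraph.Adj.reachable (G := G.induce S) hbc.1)⟩
    exact (reach v (h u u.2 v v.2)).2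

/-- `S` is a union of connected components of the subgraph induced by `P` minus `p`: one of the
pieces into which `P` is cut at `p`. -/
structure IsCutOff (G : SimpleGraph V) (P : Set V) (p : V) (S : Set V) : Prop where
  subset : S ⊆ P \ {p}
  mem_iff : ∀ u ∈ P \ {p}, ∀ v ∈ P \ {p}, G.Adj u v → (u ∈ S ↔ v ∈ S)

namespace IsCutOff

theorem diff_singleton (G : SimpleGraph V) (P : Set V) (p : V) : IsCutOff G P p (P \ {p}) :=
  ⟨subset_rfl, fun _ hu _ hv _ => iff_of_true hu hv⟩

theorem diff (hS : IsCutOff G P p S) : IsCutOff G P p ((P \ {p}) \ S) :=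
  ⟨Set.sdiff_subset, fun u hu v hv huv => and_congr (iff_of_true hu hv)
    (not_congr (hS.mem_iff u hu v hv huv))⟩

theorem eq_of_adj (hS : IsCutOff G P p S) (huv : G.Adj u v) (hu : u ∈ S) (hv : v ∈ P)
    (hvS : v ∉ S) : v = p := by
  by_contra hvp
  exact hvS ((hS.mem_iff u (hS.subset hu) v ⟨hv, hvp⟩ huv).1 hu)

theorem joinedWithin (hS : IsCutOff G P p S) (h : JoinedWithin G P u v) (hu : u ∈ S) (hv : v ∈ S)
    (hnbr : ∀ a ∈ S, ∀ b ∈ S, G.Adj p a → G.Adj p b → JoinedWithin G S a b) :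
    JoinedWithin G S u v := by
  -- A path leaves and re-enters `S` only through `p`, that is, via neighbours of `p` in `S`.
  suffices H : (v ∈ S → JoinedWithin G S u v) ∧
      (v ∉ S → ∀ b ∈ S, G.Adj p b → JoinedWithin G S u b) from H.1 hv
  clear hv
  induction h with
  | refl => exact ⟨fun _ => .refl u, fun h => absurd hu h⟩
  | @tail x y _ hxy ih =>
    obtain ⟨hadj, hx, hy⟩ := hxy
    by_cases hxS : x ∈ S
    · refine ⟨fun hyS => (ih.1 hxS).trans (.of_adj hadj hxS hyS), fun hyS b hb hpb => ?_⟩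
      obtain rfl := hS.eq_of_adj hadj hxS hy hyS
      exact (ih.1 hxS).trans (hnbr x hxS b hb hadj.symm hpb)
    · refine ⟨fun hyS => ?_, fun _ => ih.2 hxS⟩
      obtain rfl := hS.eq_of_adj hadj.symm hyS hx hxS
      exact ih.2 hxS y hyS hadj

end IsCutOff

theorem joinedWithin_compl_of_subset (hSP : S ⊆ P)
    (hP : ∀ u ∉ P, ∀ v ∉ P, JoinedWithin G Pᶜ u v)
    (hescape : ∀ u ∉ S, ∃ w ∉ P, JoinedWithin G Sᶜ u w) :
    ∀ u ∉ S, ∀ v ∉ S, JoinedWithin G Sᶜ u v := by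
  intro u hu v hv
  obtain ⟨a, ha, hua⟩ := hescape u hu
  obtain ⟨b, hb, hvb⟩ := hescape v hv
  exact hua.trans (((hP a ha b hb).mono (Set.compl_subset_compl.2 hSP)).trans hvb.symm)

end Graph

/-! ### Directions -/

/-- The six unit steps in counterclockwise order, so that directions are elements of `ZMod 6`. -/
def step : ZMod 6 → Node :=
  ![(1, 0), (0, 1), (-1, 1), (-1, 0), (0, -1), (1, -1)]

theorem step_injective : Function.Injective step := by
  unfold Function.Injective; decide

theorem step_ne_zero (i : ZMod 6) : step i ≠ 0 := by
  revert i; decide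

theorem step_add_three (i : ZMod 6) : step (i + 3) = -step i := by
  revert i; decide

theorem add_step_add_step_add_two (p : Node) (i : ZMod 6) :
    p + step i + step (i + 2) = p + step (i + 1) := by
  rw [add_assoc, add_right_inj]
  revert i; decide

theorem add_step_add_step_add_two_add_one (p : Node) (i : ZMod 6) :
    p + step i + step (i + 2 + 1) = p := by
  rw [add_assoc, add_eq_left]
  revert i; decide

theorem mem_gridSteps {d : Node} : d ∈ gridSteps ↔ ∃ i, d = step i := by
  constructor
  · revert d; decide
  · rintro ⟨i, rfl⟩; revert i; decide

theorem adj_iff_exists_step {p q : Node} : triGrid.Adj p q ↔ ∃ i, q = p + step i := by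
  change q - p ∈ gridSteps ↔ _
  simp only [mem_gridSteps, sub_eq_iff_eq_add']

theorem adj_add_step (p : Node) (i : ZMod 6) : triGrid.Adj p (p + step i) :=
  adj_iff_exists_step.2 ⟨i, rfl⟩

theorem adj_add_step_add_step_iff (p : Node) (i j : ZMod 6) :
    triGrid.Adj (p + step i) (p + step j) ↔ j = i + 1 ∨ j = i - 1 := by
  change p + step j - (p + step i) ∈ gridSteps ↔ _
  rw [add_sub_add_left_eq_sub]
  revert i j; decide

theorem adj_add_step_succ (p : Node) (i : ZMod 6) :
    triGrid.Adj (p + step i) (p + step (i + 1)) :=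
  (adj_add_step_add_step_iff p i (i + 1)).2 (.inl rfl)

theorem adj_iff_coords {p q : Node} : triGrid.Adj p q ↔
    (q.1 = p.1 + 1 ∧ q.2 = p.2) ∨ (q.1 = p.1 ∧ q.2 = p.2 + 1) ∨
    (q.1 = p.1 - 1 ∧ q.2 = p.2 + 1) ∨ (q.1 = p.1 - 1 ∧ q.2 = p.2) ∨
    (q.1 = p.1 ∧ q.2 = p.2 - 1) ∨ (q.1 = p.1 + 1 ∧ q.2 = p.2 - 1) := by
  change q - p ∈ gridSteps ↔ _
  simp only [gridSteps, Finset.mem_insert, Finset.mem_singleton, Prod.ext_iff, Prod.fst_sub,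
    Prod.snd_sub]
  omega

theorem exists_add_nsmul_step_notMem (P : Finset Node) (u : Node) (i : ZMod 6) :
    ∃ n : ℕ, u + n • step i ∉ P := by
  by_contra! hP
  have hinj : Function.Injective fun n : ℕ => u + n • step i :=
    (add_right_injective u).comp <| injective_nsmul_iff_not_isOfFinAddOrder.2 <|
      not_isOfFinAddOrder_of_isAddTorsionFree (step_ne_zero i)
  exact (Set.infinite_of_injective_forall_mem hinj hP) P.finite_toSet

/-- The directions in which `p` has a neighbour in `P`; `p` itself need not lie in `P`. -/
def nbrDirs (P : Finset Node) (p : Node) : Finset (ZMod 6) :=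
  {i | p + step i ∈ P}

theorem mem_nbrDirs {P : Finset Node} {p : Node} {i : ZMod 6} :
    i ∈ nbrDirs P p ↔ p + step i ∈ P := by
  simp [nbrDirs]

/-! ### Arcs of directions -/

/-- The `k` cyclically consecutive directions `s, s + 1, …, s + (k - 1)`. -/
def arc (s : ZMod 6) (k : ℕ) : Finset (ZMod 6) :=
  (Finset.range k).image fun j : ℕ => s + (j : ZMod 6)

theorem mem_arc {s i : ZMod 6} {k : ℕ} : i ∈ arc s k ↔ ∃ j < k, i = s + j := by
  simp [arc, eq_comm]

/-- At most three cyclically consecutive directions. The empty set is included: these are the sets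
of outgoing ports that R2 and R3 allow. -/
def ShortArc (A : Finset (ZMod 6)) : Prop :=
  ∃ s, ∃ k ≤ 3, A = arc s k

instance : DecidablePred ShortArc := fun A =>
  inferInstanceAs (Decidable (∃ s, ∃ k ≤ 3, A = arc s k))

theorem ShortArc.exists_notMem {A : Finset (ZMod 6)} (hA : ShortArc A) : ∃ i, i ∉ A := by
  obtain ⟨s, k, hk, rfl⟩ := hA
  interval_cases k <;> revert s <;> decide

theorem ShortArc.image_affine {A : Finset (ZMod 6)} (hA : ShortArc A) (c : ZMod 6)
    (ε : (ZMod 6)ˣ) : ShortArc (A.image fun i => c + ε * i) := by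
  obtain ⟨s, k, hk, rfl⟩ := hA
  rcases (by decide : ∀ ε : (ZMod 6)ˣ, ε = 1 ∨ ε = -1) ε with rfl | rfl
  · exact ⟨c + s, k, hk, by simp [arc, Finset.image_image, Function.comp_def, add_assoc]⟩
  · refine ⟨c - s + 1 - k, k, hk, ?_⟩
    interval_cases k <;> revert c s <;> decide

theorem shortArc_image_affine_iff {A : Finset (ZMod 6)} (c : ZMod 6) (ε : (ZMod 6)ˣ) :
    ShortArc (A.image fun i => c + ε * i) ↔ ShortArc A := by
  refine ⟨fun h => ?_, fun h => h.image_affine c ε⟩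
  have hinv := h.image_affine (-(ε⁻¹ * c)) ε⁻¹
  simpa [Finset.image_image, Function.comp_def, mul_add] using hinv

theorem joinedWithin_of_shortArc_nbrDirs {S : Finset Node} {p : Node} (h : ShortArc (nbrDirs S p))
    {a b : Node} (ha : a ∈ S) (hb : b ∈ S) (hpa : triGrid.Adj p a) (hpb : triGrid.Adj p b) :
    JoinedWithin triGrid S a b := by
  obtain ⟨s, k, -, hs⟩ := h
  have hmem : ∀ j < k, p + step (s + j) ∈ S := fun j hj =>
    mem_nbrDirs.1 (hs ▸ mem_arc.2 ⟨j, hj, rfl⟩)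
  have along : ∀ j < k, JoinedWithin triGrid S (p + step s) (p + step (s + j)) := by
    intro j
    induction j with
    | zero => intro _; rw [Nat.cast_zero, add_zero]; exact .refl _
    | succ j ih =>
      intro hj
      refine (ih (by omega)).trans (.of_adj ?_ (hmem j (by omega)) (hmem (j + 1) hj))
      rw [Nat.cast_succ, ← add_assoc]
      exact adj_add_step_succ p (s + j)
  have fromStart : ∀ c ∈ S, triGrid.Adj p c → JoinedWithin triGrid S (p + step s) c := by
    intro c hc hpc
    obtain ⟨i, rfl⟩ := adj_iff_exists_step.1 hpc
    obtain ⟨j, hj, rfl⟩ := mem_arc.1 (hs ▸ mem_nbrDirs.2 hc)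
    exact along j hj
  exact (fromStart a ha hpa).symm.trans (fromStart b hb hpb)

/-! ### Cutting a simply connected system at a particle -/

theorem simplyConnected_iff {P : Finset Node} : SimplyConnected P ↔
    P.Nonempty ∧ (∀ u ∈ P, ∀ v ∈ P, JoinedWithin triGrid P u v) ∧
      ∀ u ∉ P, ∀ v ∉ P, JoinedWithin triGrid (P : Set Node)ᶜ u v := by
  have : ((P : Set Node)ᶜ).Nonempty := P.finite_toSet.infinite_compl.nonempty
  rw [SimplyConnected, induce_connected_iff, induce_connected_iff, Finset.coe_nonempty, and_assoc]
  exact and_congr_right fun _ => and_congr_right fun _ => and_iff_right this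

theorem SimplyConnected.nbrDirs_nonempty {P : Finset Node} {p : Node} (hP : SimplyConnected P)
    (hp : p ∈ P) (hne : (P.erase p).Nonempty) : (nbrDirs P p).Nonempty := by
  obtain ⟨q, hq⟩ := hne
  obtain ⟨hqp, hqP⟩ := Finset.mem_erase.1 hq
  rcases ((simplyConnected_iff.1 hP).2.1 p hp q hqP).cases_head with h | ⟨c, hc, _⟩
  · exact absurd h.symm hqp
  · obtain ⟨i, rfl⟩ := adj_iff_exists_step.1 hc.1
    exact ⟨i, mem_nbrDirs.2 hc.2.2⟩

theorem IsCutOff.exists_joinedWithin_compl {P S : Finset Node} {p : Node}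
    (hS : IsCutOff triGrid P p S) {i : ZMod 6} (hi : p + step i ∉ P) {u : Node} (hu : u ∉ S) :
    ∃ w ∉ P, JoinedWithin triGrid (S : Set Node)ᶜ u w := by
  have hstep : ∀ v ∈ P, v ∉ S → v + step i ∉ S := by
    intro v hv hvS hvi
    obtain rfl := hS.eq_of_adj (adj_add_step v i).symm hvi hv hvS
    exact hi (hS.subset hvi).1
  obtain ⟨n, hn⟩ := exists_add_nsmul_step_notMem P u i
  induction n generalizing u with
  | zero => exact ⟨u, by simpa using hn, .refl u⟩
  | succ n ih =>
    by_cases huP : u ∈ P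
    · have hui := hstep u huP hu
      obtain ⟨w, hw, hj⟩ := ih hui (by rwa [add_assoc, ← succ_nsmul'])
      exact ⟨w, hw, (JoinedWithin.of_adj (adj_add_step u i) hu hui).trans hj⟩
    · exact ⟨u, huP, .refl u⟩

theorem SimplyConnected.of_isCutOff {P S : Finset Node} {p : Node} (hP : SimplyConnected P)
    (hS : IsCutOff triGrid P p S) (hne : S.Nonempty) (harc : ShortArc (nbrDirs S p))
    {i : ZMod 6} (hi : p + step i ∉ P) : SimplyConnected S := by
  obtain ⟨-, hconn, hcompl⟩ := simplyConnected_iff.1 hP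
  have hSP : (S : Set Node) ⊆ P := fun u hu => (hS.subset hu).1
  refine simplyConnected_iff.2 ⟨hne, fun u hu v hv => ?_, ?_⟩
  · exact hS.joinedWithin (hconn u (hSP hu) v (hSP hv)) hu hv fun a ha b hb =>
      joinedWithin_of_shortArc_nbrDirs harc ha hb
  · exact joinedWithin_compl_of_subset hSP hcompl fun u hu => hS.exists_joinedWithin_compl hi hu

theorem nbrDirs_erase_self (P : Finset Node) (p : Node) : nbrDirs (P.erase p) p = nbrDirs P p := by
  ext i
  simp only [mem_nbrDirs, Finset.mem_erase, ne_eq, (adj_add_step p i).ne', not_false_eq_true,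
    true_and]

theorem isCutOff_erase (P : Finset Node) (p : Node) : IsCutOff triGrid P p ↑(P.erase p) := by
  rw [Finset.coe_erase]
  exact .diff_singleton triGrid P p

theorem SimplyConnected.erase {P : Finset Node} {p : Node} (hP : SimplyConnected P)
    (harc : ShortArc (nbrDirs P p)) (hne : (P.erase p).Nonempty) :
    SimplyConnected (P.erase p) := by
  obtain ⟨i, hi⟩ := harc.exists_notMem
  exact hP.of_isCutOff (isCutOff_erase P p) hne (by rwa [nbrDirs_erase_self])
    fun h => hi (mem_nbrDirs.2 h)

/-! ### Separation -/

/-- The edge `uv` crosses the horizontal ray that runs to the left from just below `e`. -/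
def Crosses (e u v : Node) : Prop :=
  (u.2 = e.2 ∧ u.1 < e.1 ∧ v.2 = e.2 - 1) ∨ (v.2 = e.2 ∧ v.1 < e.1 ∧ u.2 = e.2 - 1)

/-- The crossing cocycle of `e` is a coboundary on `P`: no closed walk in `P` winds around `e` an
odd number of times. -/
def Unwound (P : Finset Node) (e : Node) : Prop :=
  ∃ f : Node → Prop, ∀ u ∈ P, ∀ v ∈ P, triGrid.Adj u v → (Crosses e u v ↔ ¬(f u ↔ f v))

theorem unwound_iff_of_coboundary {P : Finset Node} {e e' : Node} (g : Node → Prop)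
    (h : ∀ u ∈ P, ∀ v ∈ P, triGrid.Adj u v →
      (¬(Crosses e u v ↔ Crosses e' u v) ↔ ¬(g u ↔ g v))) :
    Unwound P e ↔ Unwound P e' := by
  constructor <;> rintro ⟨f, hf⟩ <;> refine ⟨fun u => ¬(f u ↔ g u), fun u hu v hv huv => ?_⟩ <;>
    · have hfuv := hf u hu v hv huv
      have hguv := h u hu v hv huv
      grind

theorem unwound_iff_of_adj {P : Finset Node} {e e' : Node} (hadj : triGrid.Adj e e')
    (he : e ∉ P) (he' : e' ∉ P) : Unwound P e ↔ Unwound P e' := by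
  wlog hdir : (e'.1 = e.1 - 1 ∧ e'.2 = e.2) ∨ (e'.1 = e.1 ∧ e'.2 = e.2 - 1) ∨
      (e'.1 = e.1 + 1 ∧ e'.2 = e.2 - 1) generalizing e e'
  · refine (this hadj.symm he' he ?_).symm
    rw [adj_iff_coords] at hadj
    omega
  have hne : ∀ u ∈ P, ¬(u.1 = e.1 ∧ u.2 = e.2) ∧ ¬(u.1 = e'.1 ∧ u.2 = e'.2) := fun u hu =>
    ⟨fun h => he (Prod.ext h.1 h.2 ▸ hu), fun h => he' (Prod.ext h.1 h.2 ▸ hu)⟩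
  refine unwound_iff_of_coboundary (fun u => e'.2 = e.2 - 1 ∧ u.2 = e'.2 ∧ u.1 < e'.1) ?_
  intro u hu v hv huv
  have hune := hne u hu
  have hvne := hne v hv
  rw [adj_iff_coords] at huv
  unfold Crosses
  clear hne hadj hu hv he he'
  rcases hdir with h | h | h <;> rcases huv with h' | h' | h' | h' | h' | h' <;> omega

theorem unwound_of_forall_lt {P : Finset Node} {e : Node} (he : ∀ u ∈ P, e.2 < u.2) :
    Unwound P e := by
  refine ⟨fun _ => True, fun u hu v hv _ => ?_⟩
  have := he u hu
  have := he v hv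
  simp only [Crosses, not_true, iff_false]
  omega

theorem SimplyConnected.unwound {P : Finset Node} (hP : SimplyConnected P) {e : Node}
    (he : e ∉ P) : Unwound P e := by
  obtain ⟨hne, -, hcompl⟩ := simplyConnected_iff.1 hP
  obtain ⟨b, -, hb⟩ := P.exists_min_image Prod.snd hne
  let e₀ : Node := (0, b.2 - 1)
  have hlt : ∀ u ∈ P, e₀.2 < u.2 := fun u hu => Int.sub_one_lt_of_le (hb u hu)
  have hj := hcompl e₀ (fun h => (hlt e₀ h).false) e he
  induction hj with
  | refl => exact unwound_of_forall_lt hlt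
  | tail _ hbc ih => exact (unwound_iff_of_adj hbc.1 hbc.2.1 hbc.2.2).1 (ih hbc.2.1)

/-! ### The first particle -/

/-- The order in which the nodes are scanned: by rows from bottom to top, and from left to right
inside a row. -/
def scan (v : Node) : ℤ ×ₗ ℤ :=
  toLex (v.2, v.1)

theorem scan_le_iff {u v : Node} : scan u ≤ scan v ↔ u.2 < v.2 ∨ u.2 = v.2 ∧ u.1 ≤ v.1 :=
  Prod.Lex.toLex_le_toLex

theorem scan_injective : Function.Injective scan := fun u v h => by
  simpa [scan, Prod.ext_iff, and_comm] using h

section First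

variable {P : Finset Node} {p : Node} (hfirst : ∀ v ∈ P, scan p ≤ scan v)
include hfirst

theorem nbrDirs_first_subset : nbrDirs P p ⊆ {0, 1, 2} := by
  intro i hi
  have hle := scan_le_iff.1 (hfirst _ (mem_nbrDirs.1 hi))
  simp only [Prod.fst_add, Prod.snd_add] at hle
  have hstep : 0 < (step i).2 ∨ 0 = (step i).2 ∧ 0 ≤ (step i).1 := by omega
  clear hi hle
  revert i
  decide

theorem shortArc_or_eq_of_first : ShortArc (nbrDirs P p) ∨ nbrDirs P p = {0, 2} := by
  have key : ∀ A ∈ ({0, 1, 2} : Finset (ZMod 6)).powerset, ShortArc A ∨ A = {0, 2} := by decide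
  exact key _ (Finset.mem_powerset.2 (nbrDirs_first_subset hfirst))

theorem crosses_first_iff {u v : Node} (hu : u ∈ P) (hv : v ∈ P) (huv : triGrid.Adj u v) :
    Crosses (p + step 1) u v ↔ (u = p ∧ v = p + step 2) ∨ (v = p ∧ u = p + step 2) := by
  have hpu := scan_le_iff.1 (hfirst u hu)
  have hpv := scan_le_iff.1 (hfirst v hv)
  rw [adj_iff_coords] at huv
  have step_one : step 1 = (0, 1) := rfl
  have step_two : step 2 = (-1, 1) := rfl
  simp only [Crosses, step_one, step_two, Prod.ext_iff, Prod.fst_add, Prod.snd_add]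
  rcases huv with h | h | h | h | h | h <;> omega

-- By separation, the edge from `p` to `p + step 2` is the only one that crosses a ray from the
-- empty node between the two neighbours, so the two sides of the crossing cocycle are the pieces.
theorem SimplyConnected.exists_separator (hP : SimplyConnected P) (hp : p ∈ P)
    (hnbr : nbrDirs P p = {0, 2}) : ∃ f : Node → Prop, f (p + step 0) ∧ ¬f (p + step 2) ∧
      ∀ u ∈ P, u ≠ p → ∀ v ∈ P, v ≠ p → triGrid.Adj u v → (f u ↔ f v) := by
  have mem_iff : ∀ i, p + step i ∈ P ↔ i = 0 ∨ i = 2 := fun i => by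
    rw [← mem_nbrDirs, hnbr, Finset.mem_insert, Finset.mem_singleton]
  obtain ⟨g, hg⟩ := hP.unwound (e := p + step 1) (by rw [mem_iff]; decide)
  have hcross : ∀ u ∈ P, ∀ v ∈ P, triGrid.Adj u v →
      ((g u ↔ g v) ↔ ¬(u = p ∧ v = p + step 2 ∨ v = p ∧ u = p + step 2)) :=
    fun u hu v hv huv => by
      rw [← crosses_first_iff hfirst hu hv huv, hg u hu v hv huv, not_not]
  have hp0 : p + step 0 ∈ P := (mem_iff 0).2 (.inl rfl)
  have hp2 : p + step 2 ∈ P := (mem_iff 2).2 (.inr rfl)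
  have h02 : step 0 ≠ step 2 := by decide
  refine ⟨fun u => g p ↔ g u, ?_, ?_, fun u hu hup v hv hvp huv => iff_congr Iff.rfl ?_⟩
  · simp only [hcross p hp _ hp0 (adj_add_step p 0), add_right_inj, h02, add_eq_left,
      step_ne_zero, and_false, false_and, or_self, not_false_eq_true]
  · simp only [hcross p hp _ hp2 (adj_add_step p 2), true_and, true_or, not_true,
      not_false_eq_true]
  · simp only [hcross u hu v hv huv, hup, hvp, false_and, or_self, not_false_eq_true]

theorem SimplyConnected.exists_isCutOff (hP : SimplyConnected P) (hp : p ∈ P)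
    (hnbr : nbrDirs P p = {0, 2}) : ∃ S : Finset Node, IsCutOff triGrid P p S ∧
      nbrDirs S p = {0} ∧ nbrDirs (P.erase p \ S) p = {2} := by
  classical
  obtain ⟨f, hf0, hf2, hf⟩ := hP.exists_separator hfirst hp hnbr
  have hmem : ∀ i, p + step i ∈ P.erase p ↔ i = 0 ∨ i = 2 := fun i => by
    rw [← mem_nbrDirs, nbrDirs_erase_self, hnbr, Finset.mem_insert, Finset.mem_singleton]
  refine ⟨{u ∈ P.erase p | f u}, ⟨fun u hu => ?_, fun u hu v hv huv => ?_⟩, ?_, ?_⟩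
  · rw [← Finset.coe_erase]
    exact Finset.filter_subset _ _ hu
  · simp only [Finset.mem_coe, Finset.mem_filter, Finset.mem_erase]
    exact and_congr (iff_of_true hu.symm hv.symm) (hf u hu.1 hu.2 v hv.1 hv.2 huv)
  · ext i
    rw [mem_nbrDirs, Finset.mem_filter, hmem, Finset.mem_singleton]
    constructor
    · rintro ⟨rfl | rfl, hi⟩
      exacts [rfl, absurd hi hf2]
    · rintro rfl
      exact ⟨.inl rfl, hf0⟩
  · ext i
    rw [mem_nbrDirs, Finset.mem_sdiff, Finset.mem_filter, hmem, Finset.mem_singleton]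
    constructor
    · rintro ⟨rfl | rfl, hi⟩
      exacts [absurd ⟨.inl rfl, hf0⟩ hi, rfl]
    · rintro rfl
      exact ⟨.inr rfl, fun hi => hf2 hi.2⟩

end First

/-! ### Indices and curvature -/

/-- The directions `i` in `A` for which `i + 1` lies in `A` as well. If `A` consists of the
directions of neighbours, these stand for the triangles at a node. -/
def corners (A : Finset (ZMod 6)) : Finset (ZMod 6) :=
  {i ∈ A | i + 1 ∈ A}

/-- The index of a node with outgoing edges in the directions `A`: the contribution of the node to
the Euler characteristic if each edge and each triangle is counted at its source. -/
def outIndex (A : Finset (ZMod 6)) : ℤ :=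
  1 - A.card + (corners A).card

/-- The curvature of a node with neighbours in the directions `A`: six times the contribution of the
node to the Euler characteristic if edges and triangles are shared equally by their nodes. -/
def curvature (A : Finset (ZMod 6)) : ℤ :=
  6 - 3 * A.card + 2 * (corners A).card

theorem ShortArc.outIndex_eq_ite {A : Finset (ZMod 6)} (hA : ShortArc A) :
    outIndex A = if A = ∅ then 1 else 0 := by
  obtain ⟨s, k, hk, rfl⟩ := hA
  interval_cases k <;> revert s <;> decide

theorem shortArc_of_curvature_pos {A : Finset (ZMod 6)} (hA : 0 < curvature A) : ShortArc A := by
  have key : ∀ A ∈ (Finset.univ : Finset (ZMod 6)).powerset, 0 < curvature A → ShortArc A := by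
    decide
  exact key A (by simp) hA

/-- An orientation of the edges between the nodes of `P` without cyclic triangles: `D u v` says that
the edge `uv` is directed from `u` to `v`. Values of `D` elsewhere do not matter. -/
structure TriangleAcyclic (P : Finset Node) (D : Node → Node → Prop) : Prop where
  oriented : ∀ u ∈ P, ∀ v ∈ P, triGrid.Adj u v → (D u v ↔ ¬D v u)
  not_cyclic : ∀ u ∈ P, ∀ v ∈ P, ∀ w ∈ P, triGrid.Adj u v → triGrid.Adj v w → triGrid.Adj w u →
    ¬(D u v ∧ D v w ∧ D w u)

theorem triangleAcyclic_of_injOn {α : Type*} [LinearOrder α] {P : Finset Node} {ρ : Node → α}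
    (hρ : Set.InjOn ρ P) : TriangleAcyclic P fun u v => ρ u < ρ v where
  oriented _ hu _ hv huv :=
    ⟨fun h => h.asymm, fun h => (not_lt.1 h).lt_of_ne fun h => huv.ne (hρ hu hv h)⟩
  not_cyclic _ _ _ _ _ _ _ _ _ h := (h.1.trans (h.2.1.trans h.2.2)).false

open Classical in
/-- The directions of the edges inside `P` that leave `q` in the orientation `D`. -/
noncomputable def outDirs (P : Finset Node) (D : Node → Node → Prop) (q : Node) :
    Finset (ZMod 6) :=
  {i ∈ nbrDirs P q | D q (q + step i)}

theorem mem_outDirs {P : Finset Node} {D : Node → Node → Prop} {q : Node} {i : ZMod 6} :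
    i ∈ outDirs P D q ↔ q + step i ∈ P ∧ D q (q + step i) := by
  simp only [outDirs, Finset.mem_filter, mem_nbrDirs]

/-- The sum of the indices of the nodes of `P` for the orientation `D`. -/
noncomputable def indexSum (P : Finset Node) (D : Node → Node → Prop) : ℤ :=
  ∑ q ∈ P, outIndex (outDirs P D q)

/-! ### Double counting of edges and triangles -/

theorem card_eq_mul_card_filter {α : Type*} {X : Finset α} (σ : Equiv.Perm α)
    (hσ : ∀ x, σ x ∈ X ↔ x ∈ X) (p : α → Prop) [DecidablePred p] (n : ℕ)
    (hp : ∀ x ∈ X, ∑ k ∈ Finset.range n, (if p ((σ ^ k) x) then 1 else 0) = 1) :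
    X.card = n * (X.filter p).card := by
  have hpow : ∀ k x, (σ ^ k) x ∈ X ↔ x ∈ X := fun k => by
    induction k with
    | zero => exact fun _ => Iff.rfl
    | succ k ih => exact fun x => by rw [pow_succ, Equiv.Perm.mul_apply, ih, hσ]
  calc X.card = ∑ x ∈ X, ∑ k ∈ Finset.range n, if p ((σ ^ k) x) then 1 else 0 := by
        rw [Finset.sum_congr rfl hp, Finset.card_eq_sum_ones]
    _ = ∑ k ∈ Finset.range n, ∑ x ∈ X, if p ((σ ^ k) x) then 1 else 0 := Finset.sum_comm
    _ = ∑ k ∈ Finset.range n, ∑ x ∈ X, if p x then 1 else 0 :=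
        Finset.sum_congr rfl fun k _ =>
          Finset.sum_equiv (σ ^ k) (fun x => (hpow k x).symm) fun _ _ => rfl
    _ = n * (X.filter p).card := by
        rw [Finset.sum_const, Finset.card_range, Finset.card_filter, smul_eq_mul]

/-- The reversal of directed edges, each given by its source and its direction. -/
def reverseEdge : Equiv.Perm (Σ _ : Node, ZMod 6) where
  toFun x := ⟨x.1 + step x.2, x.2 + 3⟩
  invFun x := ⟨x.1 - step (x.2 - 3), x.2 - 3⟩
  left_inv x := by simp only [add_sub_cancel_right]
  right_inv x := by simp only [sub_add_cancel]

@[simp]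
theorem reverseEdge_apply (x : Σ _ : Node, ZMod 6) :
    reverseEdge x = ⟨x.1 + step x.2, x.2 + 3⟩ := rfl

/-- The rotation of triangles to their next node in counterclockwise order. The triangle of the
nodes `q`, `q + step i`, `q + step (i + 1)` is given by `q` and `i`. -/
def rotateTriangle : Equiv.Perm (Σ _ : Node, ZMod 6) where
  toFun x := ⟨x.1 + step x.2, x.2 + 2⟩
  invFun x := ⟨x.1 - step (x.2 - 2), x.2 - 2⟩
  left_inv x := by simp only [add_sub_cancel_right]
  right_inv x := by simp only [sub_add_cancel]

@[simp]
theorem rotateTriangle_apply (x : Σ _ : Node, ZMod 6) :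
    rotateTriangle x = ⟨x.1 + step x.2, x.2 + 2⟩ := rfl

section GaussBonnet

variable {P : Finset Node} {D : Node → Node → Prop}

theorem TriangleAcyclic.sum_card_nbrDirs (hD : TriangleAcyclic P D) :
    ∑ q ∈ P, (nbrDirs P q).card = 2 * ∑ q ∈ P, (outDirs P D q).card := by
  classical
  have hout : P.sigma (outDirs P D) =
      (P.sigma (nbrDirs P)).filter fun x => D x.1 (x.1 + step x.2) := by
    ext x
    simp only [Finset.mem_sigma, Finset.mem_filter, mem_outDirs, mem_nbrDirs, and_assoc]
  rw [← Finset.card_sigma, ← Finset.card_sigma, hout]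
  refine card_eq_mul_card_filter reverseEdge (fun x => ?_) _ 2 fun x hx => ?_
  · simp [mem_nbrDirs, step_add_three, and_comm]
  · simp only [Finset.mem_sigma, mem_nbrDirs] at hx
    have hor := hD.oriented _ hx.1 _ hx.2 (adj_add_step _ _)
    simp only [Finset.sum_range_succ, Finset.sum_range_zero, pow_zero, pow_one,
      Equiv.Perm.one_apply, reverseEdge_apply, step_add_three, add_neg_cancel_right, hor]
    split_ifs <;> rfl

open Classical in
theorem TriangleAcyclic.sum_source_eq_one (hD : TriangleAcyclic P D) {u v w : Node} (hu : u ∈ P)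
    (hv : v ∈ P) (hw : w ∈ P) (huv : triGrid.Adj u v) (hvw : triGrid.Adj v w)
    (hwu : triGrid.Adj w u) :
    (if D u v ∧ D u w then 1 else 0) + (if D v w ∧ D v u then 1 else 0) +
      (if D w u ∧ D w v then 1 else 0) = 1 := by
  have := hD.oriented u hu v hv huv
  have := hD.oriented v hv w hw hvw
  have := hD.oriented w hw u hu hwu
  have := hD.not_cyclic u hu v hv w hw huv hvw hwu
  have := hD.not_cyclic u hu w hw v hv hwu.symm hvw.symm huv.symm
  split_ifs <;> first | rfl | (exfalso; tauto)

theorem TriangleAcyclic.sum_card_corners_nbrDirs (hD : TriangleAcyclic P D) :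
    ∑ q ∈ P, (corners (nbrDirs P q)).card = 3 * ∑ q ∈ P, (corners (outDirs P D q)).card := by
  classical
  have hout : (P.sigma fun q => corners (outDirs P D q)) =
      (P.sigma fun q => corners (nbrDirs P q)).filter fun x =>
        D x.1 (x.1 + step x.2) ∧ D x.1 (x.1 + step (x.2 + 1)) := by
    ext x
    simp only [Finset.mem_sigma, Finset.mem_filter, corners, mem_outDirs, mem_nbrDirs]
    tauto
  rw [← Finset.card_sigma, ← Finset.card_sigma, hout]
  refine card_eq_mul_card_filter rotateTriangle (fun x => ?_) _ 3 fun x hx => ?_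
  · simp only [Finset.mem_sigma, corners, Finset.mem_filter, mem_nbrDirs, rotateTriangle_apply,
      add_step_add_step_add_two, add_step_add_step_add_two_add_one]
    tauto
  · obtain ⟨q, i⟩ := x
    simp only [Finset.mem_sigma, corners, Finset.mem_filter, mem_nbrDirs] at hx
    obtain ⟨hq, hi, hj⟩ := hx
    have hij := add_step_add_step_add_two q i
    have hiq := add_step_add_step_add_two_add_one q i
    have hjq := add_step_add_step_add_two (q + step i) (i + 2)
    have hji := add_step_add_step_add_two_add_one (q + step i) (i + 2)
    rw [hij] at hjq hji
    rw [hiq] at hjq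
    simpa only [Finset.sum_range_succ, Finset.sum_range_zero, zero_add, pow_zero, pow_one, pow_two,
      Equiv.Perm.one_apply, Equiv.Perm.mul_apply, rotateTriangle_apply, hij, hiq, hjq, hji] using
      hD.sum_source_eq_one hq hi hj (adj_add_step q i) (adj_add_step_succ q i)
        (adj_add_step q (i + 1)).symm

theorem TriangleAcyclic.six_mul_indexSum (hD : TriangleAcyclic P D) :
    6 * indexSum P D = ∑ q ∈ P, curvature (nbrDirs P q) := by
  have hedges : (_ : ℤ) = _ := congrArg Nat.cast hD.sum_card_nbrDirs
  have htriangles : (_ : ℤ) = _ := congrArg Nat.cast hD.sum_card_corners_nbrDirs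
  push_cast at hedges htriangles
  simp only [indexSum, outIndex, curvature, Finset.sum_add_distrib, Finset.sum_sub_distrib,
    ← Finset.mul_sum, Finset.sum_const, hedges, htriangles]
  ring

end GaussBonnet

/-! ### The Poincaré–Hopf theorem -/

section Source

variable {P : Finset Node} {p : Node} {D : Node → Node → Prop}

theorem outDirs_eq_nbrDirs (hsource : ∀ v ∈ P, v ≠ p → D p v) : outDirs P D p = nbrDirs P p := by
  ext i
  rw [mem_outDirs, mem_nbrDirs]
  exact and_iff_left_of_imp fun hi => hsource _ hi (adj_add_step p i).ne'

theorem IsCutOff.outDirs_eq {S : Finset Node} (hS : IsCutOff triGrid P p S) {q : Node}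
    (hq : q ∈ S) (hqp : ¬D q p) : outDirs P D q = outDirs S D q := by
  ext i
  rw [mem_outDirs, mem_outDirs]
  refine and_congr_left fun hD => ⟨fun hi => ?_, fun hi => (hS.subset hi).1⟩
  by_contra hiS
  exact hqp (hS.eq_of_adj (adj_add_step q i) hq hi hiS ▸ hD)

end Source

/-- The orientation of the edges along the scan order. -/
def ScanLT (u v : Node) : Prop :=
  scan u < scan v

theorem IsCutOff.sum_outIndex_scanLT {P S : Finset Node} {p : Node}
    (hfirst : ∀ v ∈ P, scan p ≤ scan v) (hS : IsCutOff triGrid P p S) :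
    ∑ q ∈ S, outIndex (outDirs P ScanLT q) = indexSum S ScanLT :=
  Finset.sum_congr rfl fun q hq =>
    congrArg outIndex (hS.outDirs_eq hq (hfirst q (hS.subset hq).1).not_gt)

section First

variable {P : Finset Node} {p : Node} (hP : SimplyConnected P) (hp : p ∈ P)
  (hfirst : ∀ v ∈ P, scan p ≤ scan v)
  (ih : ∀ S ⊂ P, SimplyConnected S → indexSum S ScanLT = 1)
include hp hfirst

theorem indexSum_scanLT_eq_add : indexSum P ScanLT =
    outIndex (nbrDirs P p) + ∑ q ∈ P.erase p, outIndex (outDirs P ScanLT q) := by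
  have hsource : ∀ v ∈ P, v ≠ p → ScanLT p v := fun v hv hvp =>
    (hfirst v hv).lt_of_ne fun h => hvp (scan_injective h).symm
  rw [indexSum, ← Finset.add_sum_erase P _ hp, outDirs_eq_nbrDirs hsource]

include hP ih

theorem SimplyConnected.indexSum_scanLT_of_shortArc (harc : ShortArc (nbrDirs P p)) :
    indexSum P ScanLT = 1 := by
  rw [indexSum_scanLT_eq_add hp hfirst, harc.outIndex_eq_ite,
    (isCutOff_erase P p).sum_outIndex_scanLT hfirst]
  rcases (P.erase p).eq_empty_or_nonempty with hempty | hne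
  · have hnbr : nbrDirs P p = ∅ := by rw [← nbrDirs_erase_self, hempty]; rfl
    rw [if_pos hnbr, hempty]
    rfl
  · rw [if_neg (hP.nbrDirs_nonempty hp hne).ne_empty,
      ih _ (Finset.erase_ssubset hp) (hP.erase harc hne), zero_add]

theorem SimplyConnected.indexSum_scanLT_of_split (hnbr : nbrDirs P p = {0, 2}) :
    indexSum P ScanLT = 1 := by
  obtain ⟨S, hS, hSnbr, hTnbr⟩ := hP.exists_isCutOff hfirst hp hnbr
  have hT : IsCutOff triGrid P p ↑(P.erase p \ S) := by
    rw [Finset.coe_sdiff, Finset.coe_erase]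
    exact hS.diff
  have h1 : p + step 1 ∉ P := by rw [← mem_nbrDirs, hnbr]; decide
  have hpiece : ∀ T : Finset Node, IsCutOff triGrid P p T → ∀ i, nbrDirs T p = {i} →
      indexSum T ScanLT = 1 := by
    intro T hT i hi
    have hTP : T ⊂ P := (Finset.ssubset_iff_of_subset fun q hq => (hT.subset hq).1).2
      ⟨p, hp, fun h => (hT.subset h).2 rfl⟩
    refine ih T hTP (hP.of_isCutOff hT ⟨p + step i, mem_nbrDirs.1 (by simp [hi])⟩ ?_ h1)
    exact ⟨i, 1, by decide, by simp [hi, arc]⟩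
  have hSE : S ⊆ P.erase p := by
    rw [← Finset.coe_subset, Finset.coe_erase]
    exact hS.subset
  rw [indexSum_scanLT_eq_add hp hfirst, ← Finset.sum_sdiff hSE, hT.sum_outIndex_scanLT hfirst,
    hS.sum_outIndex_scanLT hfirst, hpiece S hS 0 hSnbr, hpiece _ hT 2 hTnbr, hnbr]
  decide

end First

theorem SimplyConnected.indexSum_scanLT {P : Finset Node} (hP : SimplyConnected P) :
    indexSum P ScanLT = 1 := by
  induction P using Finset.strongInduction with
  | H P ih =>
    obtain ⟨p, hp, hfirst⟩ := P.exists_min_image scan (simplyConnected_iff.1 hP).1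
    rcases shortArc_or_eq_of_first hfirst with harc | hnbr
    · exact hP.indexSum_scanLT_of_shortArc hp hfirst ih harc
    · exact hP.indexSum_scanLT_of_split hp hfirst ih hnbr

theorem SimplyConnected.sum_curvature {P : Finset Node} (hP : SimplyConnected P) :
    ∑ q ∈ P, curvature (nbrDirs P q) = 6 := by
  have hscan : TriangleAcyclic P ScanLT := triangleAcyclic_of_injOn scan_injective.injOn
  rw [← hscan.six_mul_indexSum, hP.indexSum_scanLT, mul_one]

theorem SimplyConnected.indexSum_eq_one {P : Finset Node} {D : Node → Node → Prop}
    (hP : SimplyConnected P) (hD : TriangleAcyclic P D) : indexSum P D = 1 := by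
  have := hD.six_mul_indexSum.trans hP.sum_curvature
  omega

/-! ### Sinks and rankings -/

theorem SimplyConnected.existsUnique_outDirs_eq_empty {P : Finset Node} {D : Node → Node → Prop}
    (hP : SimplyConnected P) (hD : TriangleAcyclic P D) (harc : ∀ q ∈ P, ShortArc (outDirs P D q)) :
    ∃! q, q ∈ P ∧ outDirs P D q = ∅ := by
  have hsum : indexSum P D = (P.filter fun q => outDirs P D q = ∅).card := by
    rw [indexSum, Finset.sum_congr rfl fun q hq => (harc q hq).outIndex_eq_ite, Finset.sum_boole]
  rw [hP.indexSum_eq_one hD, eq_comm, Nat.cast_eq_one, Finset.card_eq_one_iff_existsUnique] at hsum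
  simpa only [Finset.mem_filter] using hsum

theorem SimplyConnected.exists_shortArc_nbrDirs {P : Finset Node} (hP : SimplyConnected P) :
    ∃ p ∈ P, ShortArc (nbrDirs P p) := by
  have hpos : ∑ _q ∈ P, (0 : ℤ) < ∑ q ∈ P, curvature (nbrDirs P q) := by
    rw [hP.sum_curvature, Finset.sum_const_zero]
    decide
  obtain ⟨p, hp, hcurv⟩ := Finset.exists_lt_of_sum_lt hpos
  exact ⟨p, hp, shortArc_of_curvature_pos hcurv⟩

/-- A ranking of the nodes of `P` for which the nodes of higher rank that are adjacent to a given
node always form a short arc, so that orienting the edges towards higher ranks satisfies R1–R4. -/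
structure IsRanking (P : Finset Node) (ρ : Node → ℕ) : Prop where
  injOn : Set.InjOn ρ P
  shortArc : ∀ p ∈ P, ShortArc (outDirs P (fun u v => ρ u < ρ v) p)

theorem IsRanking.of_erase {P : Finset Node} {p : Node} {ρ : Node → ℕ}
    (hρ : IsRanking (P.erase p) ρ) (harc : ShortArc (nbrDirs P p)) :
    IsRanking P fun q => if q = p then 0 else ρ q + 1 where
  injOn u hu v hv huv := by
    by_cases hup : u = p <;> by_cases hvp : v = p <;>
      simp only [hup, hvp, if_true, if_false, Nat.add_right_cancel_iff] at huv
    · rw [hup, hvp]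
    · omega
    · omega
    · exact hρ.injOn (Finset.mem_erase.2 ⟨hup, hu⟩) (Finset.mem_erase.2 ⟨hvp, hv⟩) huv
  shortArc q hq := by
    rcases eq_or_ne q p with rfl | hqp
    · rwa [outDirs_eq_nbrDirs fun v _ hv => by simp only [if_true, hv, if_false, Nat.succ_pos]]
    · have hqE : q ∈ P.erase p := Finset.mem_erase.2 ⟨hqp, hq⟩
      rw [(isCutOff_erase P p).outDirs_eq hqE (by simp only [if_true, Nat.not_lt_zero,
        not_false_eq_true])]
      convert hρ.shortArc q hqE using 1
      ext i
      rw [mem_outDirs, mem_outDirs]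
      refine and_congr_right fun hi => ?_
      simp only [hqp, (Finset.mem_erase.1 hi).1, if_false, Nat.add_lt_add_iff_right]

theorem SimplyConnected.exists_isRanking {P : Finset Node} (hP : SimplyConnected P) :
    ∃ ρ, IsRanking P ρ := by
  induction P using Finset.strongInduction with
  | H P ih =>
    obtain ⟨p, hp, harc⟩ := hP.exists_shortArc_nbrDirs
    rcases (P.erase p).eq_empty_or_nonempty with hempty | hne
    · have hrank : IsRanking (P.erase p) 0 := ⟨by simp [hempty], by simp [hempty]⟩
      exact ⟨_, hrank.of_erase harc⟩
    · obtain ⟨ρ, hρ⟩ := ih _ (Finset.erase_ssubset hp) (hP.erase harc hne)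
      exact ⟨_, hρ.of_erase harc⟩

/-! ### Cyclic numberings -/

theorem exists_eq_add_mul_of_injective {n : ℕ} [NeZero n] {g : ZMod n → ZMod n}
    (hg : Function.Injective g) (hstep : ∀ i, g (i + 1) = g i + 1 ∨ g (i + 1) = g i - 1) :
    ∃ ε : (ZMod n)ˣ, ∀ i, g i = g 0 + ε * i := by
  have hturn : ∀ i, g (i + 1 + 1) - g (i + 1) = g (i + 1) - g i := by
    intro i
    -- A change of direction would return to `g i`, which is possible only if `1 = -1`.
    have htwo : g (i + 1 + 1) = g i → (2 : ZMod n) = 0 := fun h => by linear_combination hg h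
    rcases hstep i with h | h <;> rcases hstep (i + 1) with h' | h'
    · linear_combination h' - h
    · linear_combination h' - h - htwo (by linear_combination h' + h)
    · linear_combination h' - h + htwo (by linear_combination h' + h)
    · linear_combination h' - h
  have hdiff : ∀ m : ℕ, g (m + 1) - g m = g (0 + 1) - g 0 := by
    intro m
    induction m with
    | zero => rw [Nat.cast_zero]
    | succ m ih => rw [Nat.cast_succ, hturn, ih]
  have hlinear : ∀ m : ℕ, g m = g 0 + (g (0 + 1) - g 0) * m := by
    intro m
    induction m with
    | zero => rw [Nat.cast_zero, mul_zero, add_zero]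
    | succ m ih => rw [Nat.cast_succ]; linear_combination hdiff m + ih
  obtain ⟨ε, hε⟩ : ∃ ε : (ZMod n)ˣ, g (0 + 1) - g 0 = ε := by
    rcases hstep 0 with h | h
    · exact ⟨1, by rw [h, add_sub_cancel_left, Units.val_one]⟩
    · exact ⟨-1, by rw [h, sub_sub_cancel_left, Units.val_neg, Units.val_one]⟩
  refine ⟨ε, fun i => ?_⟩
  rw [← hε, ← ZMod.natCast_zmod_val i]
  exact hlinear i.val

/-- A numbering of the neighbours of `p` by `ZMod 6` in which consecutive neighbours are adjacent:
what a port labelling provides at each node, and what a symmetry of the grid preserves. -/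
structure IsCyclicNumbering (p : Node) (h : ZMod 6 → Node) : Prop where
  injective : Function.Injective h
  adj : ∀ i, triGrid.Adj p (h i)
  consecutive : ∀ i, triGrid.Adj (h i) (h (i + 1))

theorem PortLabelling.isCyclicNumbering (L : PortLabelling) (p : Node) :
    IsCyclicNumbering p (L.port p) :=
  ⟨L.injective p, L.adj p, L.consecutive p⟩

namespace IsCyclicNumbering

variable {p : Node} {h : ZMod 6 → Node} {P : Finset Node} {D : Node → Node → Prop}
  {A : Finset (ZMod 6)}

theorem map (hh : IsCyclicNumbering p h) (φ : triGrid ≃g triGrid) :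
    IsCyclicNumbering (φ p) (φ ∘ h) :=
  ⟨φ.injective.comp hh.injective, fun i => φ.map_adj_iff.2 (hh.adj i),
    fun i => φ.map_adj_iff.2 (hh.consecutive i)⟩

theorem exists_affine (hh : IsCyclicNumbering p h) :
    ∃ (c : ZMod 6) (ε : (ZMod 6)ˣ), ∀ i, h i = p + step (c + ε * i) := by
  choose g hg using fun i => adj_iff_exists_step.1 (hh.adj i)
  have hinj : Function.Injective g := fun i j hij => hh.injective (by rw [hg, hg, hij])
  obtain ⟨ε, hε⟩ := exists_eq_add_mul_of_injective hinj fun i => by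
    rw [← adj_add_step_add_step_iff p, ← hg, ← hg]
    exact hh.consecutive i
  exact ⟨g 0, ε, fun i => by rw [hg, hε]⟩

theorem exists_eq_of_adj (hh : IsCyclicNumbering p h) {q : Node} (hpq : triGrid.Adj p q) :
    ∃ i, h i = q := by
  obtain ⟨c, ε, hε⟩ := hh.exists_affine
  obtain ⟨j, rfl⟩ := adj_iff_exists_step.1 hpq
  exact ⟨ε⁻¹ * (j - c), by rw [hε, Units.mul_inv_cancel_left, add_sub_cancel]⟩

theorem exists_outDirs_eq_image (hh : IsCyclicNumbering p h)
    (hA : ∀ i, i ∈ A ↔ h i ∈ P ∧ D p (h i)) :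
    ∃ (c : ZMod 6) (ε : (ZMod 6)ˣ), outDirs P D p = A.image fun i => c + ε * i := by
  obtain ⟨c, ε, hε⟩ := hh.exists_affine
  refine ⟨c, ε, Finset.ext fun j => ?_⟩
  simp only [mem_outDirs, Finset.mem_image, hA, hε]
  constructor
  · intro hj
    have hinv : c + ε * (ε⁻¹ * (j - c)) = j := by rw [Units.mul_inv_cancel_left, add_sub_cancel]
    exact ⟨ε⁻¹ * (j - c), by rwa [hinv], hinv⟩
  · rintro ⟨i, hi, rfl⟩
    exact hi

theorem shortArc_outDirs_iff (hh : IsCyclicNumbering p h)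
    (hA : ∀ i, i ∈ A ↔ h i ∈ P ∧ D p (h i)) : ShortArc (outDirs P D p) ↔ ShortArc A := by
  obtain ⟨c, ε, hcε⟩ := hh.exists_outDirs_eq_image hA
  rw [hcε, shortArc_image_affine_iff]

theorem outDirs_eq_empty_iff (hh : IsCyclicNumbering p h)
    (hA : ∀ i, i ∈ A ↔ h i ∈ P ∧ D p (h i)) : outDirs P D p = ∅ ↔ A = ∅ := by
  obtain ⟨c, ε, hcε⟩ := hh.exists_outDirs_eq_image hA
  rw [hcε, Finset.image_eq_empty]

end IsCyclicNumbering

/-! ### Valid configurations as orientations -/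

section Configuration

variable {P : Finset Node} {L : PortLabelling} {C : Registers} {p : Node}

theorem marksOut_port {i : ZMod 6} : MarksOut L C p (L.port p i) ↔ C p i = .outgoing := by
  simp only [MarksOut, (L.injective p).eq_iff, exists_eq_left]

theorem mem_outPorts {i : ZMod 6} :
    i ∈ outPorts P L C p ↔ L.port p i ∈ P ∧ MarksOut L C p (L.port p i) := by
  simp only [outPorts, Finset.mem_filter_univ, marksOut_port]

theorem shortArc_outDirs_iff_shortArc_outPorts :
    ShortArc (outDirs P (MarksOut L C) p) ↔ ShortArc (outPorts P L C p) :=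
  (L.isCyclicNumbering p).shortArc_outDirs_iff fun _ => mem_outPorts

theorem isSink_iff : IsSink P L C p ↔ p ∈ P ∧ outDirs P (MarksOut L C) p = ∅ :=
  and_congr_right fun _ =>
    ((L.isCyclicNumbering p).outDirs_eq_empty_iff fun _ => mem_outPorts).symm

theorem card_arc_le (s : ZMod 6) (k : ℕ) : (arc s k).card ≤ k :=
  Finset.card_image_le.trans_eq (Finset.card_range k)

theorem lt_four_of_card_arc_le_three {s : ZMod 6} {k : ℕ} (h : (arc s k).card ≤ 3) : k < 4 := by
  by_contra! hk
  have hsub : arc s 4 ⊆ arc s k := Finset.image_subset_image (Finset.range_subset_range.2 hk)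
  have hfour : (arc s 4).card = 4 := by clear hsub h; revert s; decide
  have := Finset.card_le_card hsub
  omega

theorem atMostThree_and_consecutive_iff :
    RuleAtMostThree P L C p ∧ RuleConsecutive P L C p ↔ ShortArc (outPorts P L C p) := by
  simp only [RuleAtMostThree, RuleConsecutive, ← mem_arc, ← Finset.ext_iff]
  constructor
  · rintro ⟨hcard, s, k, hA⟩
    exact ⟨s, k, Nat.le_of_lt_succ (lt_four_of_card_arc_le_three (hA ▸ hcard)), hA⟩
  · rintro ⟨s, k, hk, hA⟩
    exact ⟨hA ▸ (card_arc_le s k).trans hk, s, k, hA⟩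

theorem locallyValid_iff : LocallyValid P L C p ↔
    RuleOriented P L C p ∧ ShortArc (outPorts P L C p) ∧ RuleNoCyclicTriangle P L C p := by
  rw [LocallyValid, ← atMostThree_and_consecutive_iff, and_assoc]

theorem TriangleAcyclic.directedEdge_iff (hD : TriangleAcyclic P (MarksOut L C)) {u v : Node} :
    DirectedEdge P L C u v ↔ u ∈ P ∧ v ∈ P ∧ triGrid.Adj u v ∧ MarksOut L C u v :=
  and_congr_right fun hu => and_congr_right fun hv => and_congr_right fun huv =>
    and_iff_left_of_imp (hD.oriented u hu v hv huv).1

theorem Valid.triangleAcyclic (h : Valid P L C) : TriangleAcyclic P (MarksOut L C) := by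
  have horiented : ∀ u ∈ P, ∀ v ∈ P, triGrid.Adj u v →
      (MarksOut L C u v ↔ ¬MarksOut L C v u) := by
    intro u hu v hv huv
    rcases (h u hu).1 v hv huv with ⟨-, -, -, huv', hvu'⟩ | ⟨-, -, -, hvu', huv'⟩
    · exact iff_of_true huv' hvu'
    · exact iff_of_false huv' (not_not.2 hvu')
  have hedge : ∀ u ∈ P, ∀ v ∈ P, triGrid.Adj u v → MarksOut L C u v → DirectedEdge P L C u v :=
    fun u hu v hv huv h => ⟨hu, hv, huv, h, (horiented u hu v hv huv).1 h⟩
  refine ⟨horiented, fun u hu v hv w hw huv hvw hwu ⟨h₁, h₂, h₃⟩ => ?_⟩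
  exact (h u hu).2.2.2 v w ⟨hedge u hu v hv huv h₁, hedge v hv w hw hvw h₂, hedge w hw u hu hwu h₃⟩

theorem TriangleAcyclic.valid (hD : TriangleAcyclic P (MarksOut L C))
    (harc : ∀ p ∈ P, ShortArc (outDirs P (MarksOut L C) p)) : Valid P L C := by
  refine fun p hp => locallyValid_iff.2
    ⟨fun q hq hpq => ?_, shortArc_outDirs_iff_shortArc_outPorts.1 (harc p hp), fun q r h => ?_⟩
  · simp only [hD.directedEdge_iff, hp, hq, hpq, hpq.symm, true_and]
    rw [hD.oriented p hp q hq hpq]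
    exact (em _).symm
  · simp only [hD.directedEdge_iff] at h
    obtain ⟨⟨-, hq, hpq, h₁⟩, ⟨-, hr, hqr, h₂⟩, -, -, hrp, h₃⟩ := h
    exact hD.not_cyclic p hp q hq r hr hpq hqr hrp ⟨h₁, h₂, h₃⟩

theorem valid_iff : Valid P L C ↔
    TriangleAcyclic P (MarksOut L C) ∧ ∀ p ∈ P, ShortArc (outDirs P (MarksOut L C) p) :=
  ⟨fun h => ⟨h.triangleAcyclic, fun p hp => shortArc_outDirs_iff_shortArc_outPorts.2
    (locallyValid_iff.1 (h p hp)).2.1⟩, fun h => h.1.valid h.2⟩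

theorem SimplyConnected.existsUnique_isSink (hP : SimplyConnected P) (h : Valid P L C) :
    ∃! p, IsSink P L C p := by
  obtain ⟨hD, harc⟩ := valid_iff.1 h
  simpa only [isSink_iff] using hP.existsUnique_outDirs_eq_empty hD harc

end Configuration

/-! ### Acyclic certificates -/

section Ranking

variable {P : Finset Node} {ρ : Node → ℕ}

/-- The certificates that direct every edge from lower to higher rank. -/
def registersOfRank (L : PortLabelling) (ρ : Node → ℕ) : Registers := fun p i =>
  if ρ p < ρ (L.port p i) then .outgoing else .incoming

theorem marksOut_registersOfRank {L : PortLabelling} {p q : Node} (hpq : triGrid.Adj p q) :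
    MarksOut L (registersOfRank L ρ) p q ↔ ρ p < ρ q := by
  obtain ⟨i, rfl⟩ := (L.isCyclicNumbering p).exists_eq_of_adj hpq
  rw [marksOut_port, registersOfRank]
  split_ifs with h <;> simp [h]

theorem IsRanking.valid (hρ : IsRanking P ρ) (L : PortLabelling) :
    Valid P L (registersOfRank L ρ) := by
  have hlt : TriangleAcyclic P fun u v => ρ u < ρ v := triangleAcyclic_of_injOn hρ.injOn
  refine valid_iff.2 ⟨⟨fun u hu v hv huv => ?_, fun u hu v hv w hw huv hvw hwu => ?_⟩,
    fun p hp => ?_⟩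
  · rw [marksOut_registersOfRank huv, marksOut_registersOfRank huv.symm]
    exact hlt.oriented u hu v hv huv
  · rw [marksOut_registersOfRank huv, marksOut_registersOfRank hvw, marksOut_registersOfRank hwu]
    exact hlt.not_cyclic u hu v hv w hw huv hvw hwu
  · convert hρ.shortArc p hp using 1
    ext i
    rw [mem_outDirs, mem_outDirs, marksOut_registersOfRank (adj_add_step p i)]

theorem not_onDirectedCycle_registersOfRank (P : Finset Node) (L : PortLabelling)
    (ρ : Node → ℕ) (p : Node) : ¬OnDirectedCycle P L (registersOfRank L ρ) p := by
  intro hcycle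
  have hlt : Relation.TransGen (· < ·) (ρ p) (ρ p) := hcycle.lift ρ
    fun _ _ ⟨_, _, huv, hout, _⟩ => (marksOut_registersOfRank huv).1 hout
  rw [Relation.transGen_eq_self] at hlt
  exact lt_irrefl _ hlt

theorem SimplyConnected.exists_acyclic_registers (hP : SimplyConnected P) (L : PortLabelling) :
    ∃ C : Registers, Valid P L C ∧ ∀ p, ¬OnDirectedCycle P L C p := by
  obtain ⟨ρ, hρ⟩ := hP.exists_isRanking
  exact ⟨registersOfRank L ρ, hρ.valid L, not_onDirectedCycle_registersOfRank P L ρ⟩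

end Ranking

/-! ### Locality -/

section Locality

variable {φ : triGrid ≃g triGrid} {P P' : Finset Node} {L L' : PortLabelling} {C C' : Registers}
  {p : Node}

namespace SameView

theorem directedEdge_iff (h : SameView φ P L C P' L' C' p) {u v : Node}
    (hu : u = p ∨ triGrid.Adj p u) (hv : v = p ∨ triGrid.Adj p v) :
    DirectedEdge P L C u v ↔ DirectedEdge P' L' C' (φ u) (φ v) := by
  rw [DirectedEdge, DirectedEdge, ← (h u hu).1, ← (h v hv).1, φ.map_adj_iff]
  refine and_congr_right fun huP => and_congr_right fun hvP => and_congr_right fun huv => ?_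
  rw [(h u hu).2 huP v huv, (h v hv).2 hvP u huv.symm]

theorem ruleOriented_iff (h : SameView φ P L C P' L' C' p) :
    RuleOriented P L C p ↔ RuleOriented P' L' C' (φ p) := by
  refine (forall_congr' fun q => ?_).trans φ.surjective.forall.symm
  rw [φ.map_adj_iff, imp.swap, imp.swap (a := φ q ∈ P')]
  refine imp_congr_right fun hpq => ?_
  rw [(h q (.inr hpq)).1, h.directedEdge_iff (.inl rfl) (.inr hpq),
    h.directedEdge_iff (.inr hpq) (.inl rfl)]

theorem shortArc_outPorts_iff (h : SameView φ P L C P' L' C' p) (hp : p ∈ P) :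
    ShortArc (outPorts P L C p) ↔ ShortArc (outPorts P' L' C' (φ p)) := by
  rw [← shortArc_outDirs_iff_shortArc_outPorts (p := φ p)]
  refine (((L.isCyclicNumbering p).map φ).shortArc_outDirs_iff fun i => ?_).symm
  rw [mem_outPorts, (h _ (.inr (L.adj p i))).1, (h p (.inl rfl)).2 hp _ (L.adj p i),
    Function.comp_apply]

theorem ruleNoCyclicTriangle_iff (h : SameView φ P L C P' L' C' p) :
    RuleNoCyclicTriangle P L C p ↔ RuleNoCyclicTriangle P' L' C' (φ p) := by
  refine (forall_congr' fun q => ?_).trans φ.surjective.forall.symm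
  refine (forall_congr' fun r => ?_).trans φ.surjective.forall.symm
  by_cases hnear : triGrid.Adj p q ∧ triGrid.Adj r p
  · have hq : q = p ∨ triGrid.Adj p q := .inr hnear.1
    have hr : r = p ∨ triGrid.Adj p r := .inr hnear.2.symm
    rw [h.directedEdge_iff (.inl rfl) hq, h.directedEdge_iff hq hr,
      h.directedEdge_iff hr (.inl rfl)]
  · refine iff_of_true (fun hcyc => ?_) (fun hcyc => ?_)
    · exact hnear ⟨hcyc.1.2.2.1, hcyc.2.2.2.2.1⟩
    · exact hnear ⟨φ.map_adj_iff.1 hcyc.1.2.2.1, φ.map_adj_iff.1 hcyc.2.2.2.2.1⟩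

theorem locallyValid_iff (h : SameView φ P L C P' L' C' p) (hp : p ∈ P) :
    LocallyValid P L C p ↔ LocallyValid P' L' C' (φ p) := by
  rw [_root_.locallyValid_iff, _root_.locallyValid_iff, h.ruleOriented_iff,
    h.shortArc_outPorts_iff hp, h.ruleNoCyclicTriangle_iff]

end SameView

end Locality

/-! ### A valid configuration with a directed cycle -/

/-- A node and its six neighbours: the system of the directed cycle that R4 does not exclude. -/
def hexagon : Finset Node :=
  {(0, 0), (1, 0), (0, 1), (-1, 1), (-1, 0), (0, -1), (1, -1)}

/-- The port labelling that numbers the ports of all nodes in the same way. -/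
def standardLabelling : PortLabelling where
  port p i := p + step i
  injective _ _ _ h := step_injective (add_left_cancel h)
  adj := adj_add_step
  consecutive := adj_add_step_succ

/-- The certificates of a directed cycle: every node of the rim of the hexagon points to the next
one and to the centre. -/
def hexagonRegisters : Registers := fun p j =>
  if ∃ k, p = step k ∧ (j = k + 2 ∨ j = k + 3) then .outgoing else .incoming

theorem mem_hexagon {v : Node} : v ∈ hexagon ↔
    -1 ≤ v.1 ∧ v.1 ≤ 1 ∧ -1 ≤ v.2 ∧ v.2 ≤ 1 ∧ -1 ≤ v.1 + v.2 ∧ v.1 + v.2 ≤ 1 := by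
  simp only [hexagon, Finset.mem_insert, Finset.mem_singleton, Prod.ext_iff]
  omega

theorem joinedWithin_add_zsmul_step {S : Set Node} {u : Node} {i : ZMod 6}
    (h : ∀ n : ℤ, u + n • step i ∈ S) (n : ℤ) : JoinedWithin triGrid S u (u + n • step i) := by
  have hadj : ∀ m : ℤ,
      JoinedWithin triGrid S (u + m • step i) (u + (m + 1) • step i) := by
    intro m
    refine .of_adj ?_ (h m) (h (m + 1))
    rw [add_zsmul, one_zsmul, ← add_assoc]
    exact adj_add_step _ i
  induction n with
  | zero => rw [zero_zsmul, add_zero]; exact .refl u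
  | succ n ih => exact ih.trans (hadj n)
  | pred n ih => exact ih.trans (by simpa only [sub_add_cancel] using (hadj (-n - 1)).symm)

theorem joinedWithin_row {S : Set Node} {y : ℤ} (h : ∀ x, (x, y) ∈ S) (a b : ℤ) :
    JoinedWithin triGrid S (a, y) (b, y) := by
  have hline := joinedWithin_add_zsmul_step (S := S) (u := (a, y)) (i := 0)
    (fun n => by simpa [step] using h (a + n)) (b - a)
  simpa [step] using hline

theorem joinedWithin_column {S : Set Node} {x : ℤ} (h : ∀ y, (x, y) ∈ S) (a b : ℤ) :
    JoinedWithin triGrid S (x, a) (x, b) := by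
  have hline := joinedWithin_add_zsmul_step (S := S) (u := (x, a)) (i := 1)
    (fun n => by simpa [step] using h (a + n)) (b - a)
  simpa [step] using hline

theorem joinedWithin_hexagon_zero {u : Node} (hu : u ∈ hexagon) :
    JoinedWithin triGrid hexagon u 0 := by
  by_cases h0 : u = 0
  · rw [h0]
    exact .refl 0
  · refine .of_adj ?_ hu (by decide : (0 : Node) ∈ hexagon)
    rw [Prod.ext_iff] at h0
    rw [mem_hexagon] at hu
    rw [adj_iff_coords]
    simp only [Prod.fst_zero, Prod.snd_zero] at h0 ⊢
    omega

theorem joinedWithin_compl_hexagon {u : Node} (hu : u ∉ hexagon) :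
    JoinedWithin triGrid (hexagon : Set Node)ᶜ u (2, 2) := by
  have hrow : ∀ y : ℤ, y ≤ -2 ∨ 2 ≤ y → ∀ a b : ℤ,
      JoinedWithin triGrid (hexagon : Set Node)ᶜ (a, y) (b, y) := fun y hy =>
    joinedWithin_row fun x hx => by
      have := mem_hexagon.1 hx
      omega
  have hcolumn : ∀ x : ℤ, x ≤ -2 ∨ 2 ≤ x → ∀ a b : ℤ,
      JoinedWithin triGrid (hexagon : Set Node)ᶜ (x, a) (x, b) := fun x hx =>
    joinedWithin_column fun y hy => by
      have := mem_hexagon.1 hy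
      omega
  obtain ⟨x, y⟩ := u
  by_cases hx : x ≤ -2 ∨ 2 ≤ x
  · exact (hcolumn x hx y 2).trans (hrow 2 (by omega) x 2)
  by_cases hy : y ≤ -2 ∨ 2 ≤ y
  · exact (hrow y hy x 2).trans (hcolumn 2 (by omega) y 2)
  -- Inside the bounding square only two corners are missing from the hexagon.
  obtain ⟨rfl, rfl⟩ | ⟨rfl, rfl⟩ : (x = 1 ∧ y = 1) ∨ (x = -1 ∧ y = -1) := by
    rw [mem_hexagon] at hu
    omega
  · exact (JoinedWithin.of_adj (adj_add_step (1, 1) 0) hu (by decide)).trans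
      (hcolumn 2 (by omega) 1 2)
  · exact (JoinedWithin.of_adj (adj_add_step (-1, -1) 3) hu (by decide)).trans
      ((hcolumn (-2) (by omega) (-1) 2).trans (hrow 2 (by omega) (-2) 2))

theorem simplyConnected_hexagon : SimplyConnected hexagon :=
  simplyConnected_iff.2 ⟨⟨0, by decide⟩,
    fun _ hu _ hv => (joinedWithin_hexagon_zero hu).trans (joinedWithin_hexagon_zero hv).symm,
    fun _ hu _ hv => (joinedWithin_compl_hexagon hu).trans (joinedWithin_compl_hexagon hv).symm⟩

instance : DecidableRel triGrid.Adj := fun p q =>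
  inferInstanceAs (Decidable (q - p ∈ gridSteps))

instance (L : PortLabelling) (C : Registers) : DecidableRel (MarksOut L C) := fun p q =>
  inferInstanceAs (Decidable (∃ i, L.port p i = q ∧ C p i = .outgoing))

instance (P : Finset Node) (L : PortLabelling) (C : Registers) :
    DecidableRel (DirectedEdge P L C) := fun p q =>
  inferInstanceAs (Decidable (p ∈ P ∧ q ∈ P ∧ triGrid.Adj p q ∧ MarksOut L C p q ∧
    ¬MarksOut L C q p))

theorem triangleAcyclic_hexagon :
    TriangleAcyclic hexagon (MarksOut standardLabelling hexagonRegisters) :=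
  ⟨by decide, by decide⟩

theorem valid_hexagon : Valid hexagon standardLabelling hexagonRegisters :=
  triangleAcyclic_hexagon.valid fun p hp => shortArc_outDirs_iff_shortArc_outPorts.2 <| by
    revert p
    decide

theorem onDirectedCycle_hexagon :
    OnDirectedCycle hexagon standardLabelling hexagonRegisters (step 0) := by
  have hrim : ∀ i, DirectedEdge hexagon standardLabelling hexagonRegisters
      (step i) (step (i + 1)) := by decide
  exact (((((Relation.TransGen.single (hrim 0)).tail (hrim 1)).tail (hrim 2)).tail (hrim 3)).tail
    (hrim 4)).tail (hrim 5)

theorem card_register : Nat.card Register = 2 ^ 6 := by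
  have hlink : Nat.card Link = 2 :=
    Nat.card_eq_two_iff.2 ⟨.incoming, .outgoing, by decide, by ext l; cases l <;> simp⟩
  rw [Register, Nat.card_fun, hlink, Nat.card_zmod]

/-- R1–R4 form a proof-labelling scheme for leader election with certificates of constant size:
* soundness: in a simply connected system every valid configuration has exactly one sink;
* completeness: every simply connected system has a valid configuration, even an acyclic one;
* a certificate is one of `2 ^ 6` values, and whether a particle satisfies R1–R4 depends only on
  what is seen at distance at most one from it, up to symmetries of the grid;
* a valid configuration may contain directed cycles. -/
theorem theorem1 :
    (∀ (P : Finset Node) (L : PortLabelling) (C : Registers),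
      SimplyConnected P → Valid P L C → ∃! p, IsSink P L C p) ∧
    (∀ (P : Finset Node) (L : PortLabelling),
      SimplyConnected P → ∃ C : Registers, Valid P L C ∧ ∀ p, ¬ OnDirectedCycle P L C p) ∧
    Nat.card Register = 2 ^ 6 ∧
    (∀ (φ : triGrid ≃g triGrid) (P : Finset Node) (L : PortLabelling) (C : Registers)
      (P' : Finset Node) (L' : PortLabelling) (C' : Registers) (p : Node),
      p ∈ P → SameView φ P L C P' L' C' p →
        (LocallyValid P L C p ↔ LocallyValid P' L' C' (φ p))) ∧
    (∃ (P : Finset Node) (L : PortLabelling) (C : Registers) (p : Node),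
      SimplyConnected P ∧ Valid P L C ∧ OnDirectedCycle P L C p) :=
  ⟨fun _ _ _ hP h => hP.existsUnique_isSink h, fun _ L hP => hP.exists_acyclic_registers L,
    card_register, fun _ _ _ _ _ _ _ _ hp h => h.locallyValid_iff hp,
    hexagon, standardLabelling, hexagonRegisters, step 0,
    simplyConnected_hexagon, valid_hexagon, onDirectedCycle_hexagon⟩
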